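/- Let $d\ge 1$, let $r\ge 1$ be real, and let $\boldsymbol\sigma=(\sigma_1,\dots,\sigma_d)$ and $(\delta_1,\dots,\delta_d)$ have positive entries. Let $f$ belong to the Bernstein class $B^r_{\boldsymbol\sigma,d}$, that is, $f:\mathbb C^d\to\mathbb C$ is an entire function of exponential type at most $\boldsymbol\sigma$ (for every $\varepsilon>0$ there is a constant $A_\varepsilon$ with $|f(z)|\le A_\varepsilon\exp\big(\sum_{j=1}^d(\sigma_j+\varepsilon)|z_j|\big)$ for all $z\in\mathbb C^d$) whose restriction to $\mathbb R^d$ lies in $L^r(\mathbb R^d)$. For each $\ell=1,\dots,d$ let $(t^{(\ell)}_{n})_{n\in\mathbb Z}$ be a real sequence with \[ \inf_{n\ne m}\big|t^{(\ell)}_{n}-t^{(\ell)}_{m}\big|\ge\delta_\ell , \] and for $\mathbf n=(n_1,\dots,n_d)\in\mathbb Z^d$ put $t_{\mathbf n}=(t^{(1)}_{n_1},\dots,t^{(d)}_{n_d})\in\mathbb R^d$. Then the series on the left converges and \[ \sum_{\mathbf n\in\mathbb Z^d}|f(t_{\mathbf n})|^r\le \mathfrak B_{d,r}\,\|f\|_r^r,\qquad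 \mathfrak B_{d,r}=\Big(\frac{8}{r\pi}\Big)^d\prod_{\ell=1}^d\frac{e^{r\delta_\ell\sigma_\ell/2}-1}{\sigma_\ell\,\delta_\ell^2}, \] where $\|f\|_r$ is the $L^r(\mathbb R^d)$-norm of the restriction of $f$ to $\mathbb R^d$. -/

import Mathlib

open MeasureTheory
open scoped ENNReal

/-- The restriction of a function on `ℂ^d` to `ℝ^d`. -/
def restrictReal {d : ℕ} (f : (Fin d → ℂ) → ℂ) : (Fin d → ℝ) → ℂ :=
  fun x => f (fun j => (x j : ℂ))

/-- `f : ℂ^d → ℂ` is an entire function of exponential type at most `σ = (σ_1, …, σ_d)`: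
it is entire, and for every `ε > 0` there is a constant `A` such that
`|f(z)| ≤ A exp(∑_j (σ_j + ε) |z_j|)` for all `z ∈ ℂ^d`. -/
def IsEntireOfExpType {d : ℕ} (σ : Fin d → ℝ) (f : (Fin d → ℂ) → ℂ) : Prop :=
  Differentiable ℂ f ∧
    ∀ ε : ℝ, 0 < ε → ∃ A : ℝ, ∀ z : Fin d → ℂ,
      ‖f z‖ ≤ A * Real.exp (∑ j, (σ j + ε) * ‖z j‖)

/-- The Bernstein class: entire functions on `ℂ^d` of exponential type at most `σ` whose
restriction to `ℝ^d` lies in `L^p(ℝ^d)` with respect to Lebesgue measure. -/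
def bernsteinClass {d : ℕ} (σ : Fin d → ℝ) (p : ℝ≥0∞) : Set ((Fin d → ℂ) → ℂ) :=
  {f | IsEntireOfExpType σ f ∧ MemLp (restrictReal f) p volume}

/-- The constant `(8 / (r π))^d ∏_ℓ (exp(r δ_ℓ σ_ℓ / 2) - 1) / (σ_ℓ δ_ℓ²)`. -/
noncomputable def plancherelPolyaConst {d : ℕ} (r : ℝ) (σ δ : Fin d → ℝ) : ℝ :=
  (8 / (r * Real.pi)) ^ d *
    ∏ l, (Real.exp (r * δ l * σ l / 2) - 1) / (σ l * δ l ^ 2)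

/-!
The proof combines a sub-mean-value inequality with the Plancherel–Pólya inequality.

Since `f` is entire and `1 ≤ r`, the value `|f(t_n)|^r` is at most the mean of `|f|^r` over the
polydisc of radii `δ_l / 2` around `t_n` (`enorm_rpow_mul_volume_polydisc_le`). By the separation
hypothesis these polydiscs are pairwise disjoint, and all of them lie in the strip
`|Im z_l| ≤ δ_l / 2`. So the sum is at most `∏ 4 / (π δ_l²)` times the integral of `|f|^r` over
the strip (`tsum_enorm_rpow_le`).

On each slice `ℝ^d + i y` of the strip, the integral of `|f|^r` is at most
`exp (r ∑ σ_l |y_l|) ‖f‖_r^r` (`lintegral_enorm_rpow_add_mul_I_le`). Integrating over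
`|y_l| ≤ δ_l / 2` gives the factor `∏ 2 (exp (r σ_l δ_l / 2) - 1) / (r σ_l)`
(`lintegral_strip_le`), and the product of the two factors is the constant of the theorem.

The slice inequality is proved by duality, in all variables at once. For `g` supported in a compact
set, `h(w) = ∫ f(s + w y) g(s) ds` is an entire function of the single variable `w`, of exponential
type `∑ σ_l |y_l|`, and on the real line it is bounded by `‖f‖_r` times the dual norm of `g`. The
Phragmén–Lindelöf principle (`norm_apply_I_le_of_exp_type`) bounds `h(i)`, and choosing `g` dual to
`s ↦ f(s + i y)` turns this into the bound for the norm on the slice.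
-/

/-! ### Tools: Phragmén–Lindelöf, holomorphic parameter integrals, Hölder -/

/-- A Phragmén–Lindelöf estimate: an entire function of exponential type `τ` bounded by `M` on the
real line is at most `e^τ M` at `i`. The half-plane theorem is applied to `h (i w) e^{-τ w}` on
`0 < Re w`, which is bounded on the positive half-line precisely because `h` is
`O (e^{τ |w|})` with the same `τ`. -/
theorem norm_apply_I_le_of_exp_type {h : ℂ → ℂ} (hh : Differentiable ℂ h) {A τ M : ℝ}
    (hA : ∀ w, ‖h w‖ ≤ A * Real.exp (τ * ‖w‖)) (hM : ∀ x : ℝ, ‖h x‖ ≤ M) :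
    ‖h Complex.I‖ ≤ Real.exp τ * M := by
  have hA0 : 0 ≤ A := by simpa using (norm_nonneg _).trans (hA 0)
  set k : ℂ → ℂ := fun w => h (Complex.I * w) * Complex.exp (-(τ * w)) with hk
  have hkn : ∀ w, ‖k w‖ ≤ A * Real.exp (τ * ‖w‖ - τ * w.re) := by
    intro w
    have h1 : ‖k w‖ = ‖h (Complex.I * w)‖ * Real.exp (-(τ * w.re)) := by
      simp [hk, Complex.norm_exp]
    rw [h1, sub_eq_add_neg, Real.exp_add, ← mul_assoc]
    gcongr
    simpa using hA (Complex.I * w)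
  have hkd : Differentiable ℂ k := by
    simp only [hk]; fun_prop
  have key : ‖k 1‖ ≤ M := by
    refine PhragmenLindelof.right_half_plane_of_bounded_on_real hkd.diffContOnCl
      ⟨1, by norm_num, 2 * |τ|, ?_⟩ ?_ ?_ (by simp)
    · refine Asymptotics.IsBigO.of_bound A (Filter.Eventually.of_forall fun w => ?_)
      refine (hkn w).trans ?_
      rw [Real.rpow_one, Real.norm_eq_abs, Real.abs_exp]
      gcongr
      have h1 : τ * ‖w‖ ≤ |τ| * ‖w‖ := by gcongr; exact le_abs_self τ
      have h2 : -(τ * w.re) ≤ |τ| * ‖w‖ := by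
        refine (neg_le_abs _).trans ?_
        rw [abs_mul]
        gcongr
        exact Complex.abs_re_le_norm w
      linarith
    · refine Filter.isBoundedUnder_of_eventually_le (a := A) ?_
      filter_upwards [Filter.eventually_ge_atTop (0 : ℝ)] with x hx
      simpa [abs_of_nonneg hx] using hkn x
    · intro x
      have h1 : Complex.I * (x * Complex.I) = ((-x : ℝ) : ℂ) := by
        push_cast
        linear_combination (x : ℂ) * Complex.I_mul_I
      simpa [hk, Complex.norm_exp, h1] using hM (-x)
  have h2 : ‖k 1‖ = ‖h Complex.I‖ * Real.exp (-τ) := by simp [hk, Complex.norm_exp]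
  rw [h2, Real.exp_neg, ← div_eq_mul_inv, div_le_iff₀ (Real.exp_pos τ)] at key
  linarith

theorem differentiable_integral_mul_of_isCompact {X : Type*} [TopologicalSpace X]
    [MeasurableSpace X] [OpensMeasurableSpace X] [SecondCountableTopology X]
    {μ : Measure X} [IsFiniteMeasureOnCompacts μ]
    {K : Set X} (hK : IsCompact K) (hKm : MeasurableSet K)
    {Φ : X → ℂ → ℂ} (hΦc : Continuous Φ.uncurry) (hΦd : ∀ s, Differentiable ℂ (Φ s))
    {g : X → ℂ} (hg : Measurable g) {C : ℝ} (hgC : ∀ s ∈ K, ‖g s‖ ≤ C) :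
    Differentiable ℂ (fun w => ∫ s in K, Φ s w * g s ∂μ) := by
  intro w₀
  obtain ⟨B, hB⟩ := (hK.prod (isCompact_closedBall w₀ 2)).exists_bound_of_continuousOn
    hΦc.continuousOn
  have hfin : IsFiniteMeasure (μ.restrict K) := ⟨by simpa using hK.measure_lt_top⟩
  have hmeas : ∀ w, AEStronglyMeasurable (fun s => Φ s w * g s) (μ.restrict K) := fun w =>
    (((hΦc.comp (Continuous.prodMk_left w)).measurable).mul hg).aestronglyMeasurable
  -- Cauchy's estimate on circles of radius `1` bounds the derivative by the bound on radius `2`.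
  have hbd : ∀ᵐ s ∂μ.restrict K, ∀ w ∈ Metric.ball w₀ 1, ‖deriv (Φ s) w * g s‖ ≤ B * C := by
    filter_upwards [ae_restrict_mem hKm] with s hs w hw
    have h1 : ‖deriv (Φ s) w‖ ≤ B / 1 := by
      refine Complex.norm_deriv_le_of_forall_mem_sphere_norm_le one_pos
        (hΦd s).diffContOnCl fun z hz => hB (s, z) ⟨hs, ?_⟩
      have := dist_triangle z w w₀
      simp only [Metric.mem_ball, Metric.mem_sphere, Metric.mem_closedBall] at *
      linarith
    rw [div_one] at h1
    rw [norm_mul]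
    exact mul_le_mul h1 (hgC s hs) (norm_nonneg _) ((norm_nonneg _).trans h1)
  refine (hasDerivAt_integral_of_dominated_loc_of_deriv_le
    (Metric.ball_mem_nhds w₀ one_pos) (Filter.Eventually.of_forall hmeas)
    (F' := fun w s => deriv (Φ s) w * g s) (bound := fun _ => B * C) ?_ ?_ hbd
    (integrable_const _) ?_).2.differentiableAt
  · refine Integrable.of_bound (hmeas w₀) (B * C) ?_
    filter_upwards [ae_restrict_mem hKm] with s hs
    have h1 : ‖Φ s w₀‖ ≤ B := hB (s, w₀) ⟨hs, by simp⟩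
    rw [norm_mul]
    exact mul_le_mul h1 (hgC s hs) (norm_nonneg _) ((norm_nonneg _).trans h1)
  · exact (((measurable_deriv_with_param hΦc).comp measurable_prodMk_right).mul
      hg).aestronglyMeasurable
  · exact Filter.Eventually.of_forall fun s w _ =>
      ((hΦd s w).hasDerivAt).mul_const (g s)

/-- The `r`-th power of Hölder's inequality with exponents `r` and `r / (r - 1)`, in a form that
includes `r = 1`. -/
theorem lintegral_mul_rpow_le {α : Type*} [MeasurableSpace α] {μ : Measure α}
    {u v : α → ℝ≥0∞} (hu : AEMeasurable u μ) (hv : AEMeasurable v μ) {r : ℝ} (hr : 1 ≤ r) :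
    (∫⁻ a, u a * v a ^ (r - 1) ∂μ) ^ r ≤
      (∫⁻ a, u a ^ r ∂μ) * (∫⁻ a, v a ^ r ∂μ) ^ (r - 1) := by
  have hr0 : 0 < r := by linarith
  have h := ENNReal.lintegral_mul_norm_pow_le (hu.pow_const r) (hv.pow_const r)
    (p := 1 / r) (q := (r - 1) / r) (by positivity) (div_nonneg (by linarith) hr0.le)
    (by field_simp; ring)
  have e : ∀ a, (u a ^ r) ^ (1 / r) * (v a ^ r) ^ ((r - 1) / r) = u a * v a ^ (r - 1) := by
    intro a
    rw [← ENNReal.rpow_mul, ← ENNReal.rpow_mul, mul_one_div_cancel hr0.ne', ENNReal.rpow_one,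
      mul_div_cancel₀ _ hr0.ne']
  simp_rw [e] at h
  refine (ENNReal.rpow_le_rpow h hr0.le).trans_eq ?_
  rw [ENNReal.mul_rpow_of_nonneg _ _ hr0.le, ← ENNReal.rpow_mul, ← ENNReal.rpow_mul,
    one_div_mul_cancel hr0.ne', ENNReal.rpow_one, div_mul_cancel₀ _ hr0.ne']

/-! ### The Plancherel–Pólya inequality on real translates -/

/-- The function `z ↦ conj z * |z| ^ (r - 2)` dual to `z` in the sense of `L^r`: its product with
`z` is `|z| ^ r` and its modulus is `|z| ^ (r - 1)` for `z ≠ 0`. At `z = 0` the factor `conj z`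
makes it vanish, whatever the value of `0 ^ (r - 2)`. -/
noncomputable def conjMulPow (r : ℝ) (z : ℂ) : ℂ :=
  (starRingEnd ℂ) z * ((‖z‖ ^ (r - 2) : ℝ) : ℂ)

theorem measurable_conjMulPow (r : ℝ) : Measurable (conjMulPow r) := by
  unfold conjMulPow
  refine Continuous.measurable Complex.continuous_conj |>.mul ?_
  exact Complex.measurable_ofReal.comp (measurable_norm.pow_const _)

theorem mul_conjMulPow {r : ℝ} (hr : 1 ≤ r) (z : ℂ) :
    z * conjMulPow r z = ((‖z‖ ^ r : ℝ) : ℂ) := by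
  rcases eq_or_ne z 0 with rfl | hz
  · simp [Real.zero_rpow (by linarith : r ≠ 0)]
  · have hz' : 0 < ‖z‖ := norm_pos_iff.2 hz
    rw [conjMulPow, ← mul_assoc, Complex.mul_conj']
    rw [← Complex.ofReal_pow, ← Complex.ofReal_mul, ← Real.rpow_natCast, ← Real.rpow_add hz']
    congr 2
    push_cast; ring

theorem norm_conjMulPow_le (r : ℝ) (z : ℂ) : ‖conjMulPow r z‖ ≤ ‖z‖ ^ (r - 1) := by
  rcases eq_or_ne z 0 with rfl | hz
  · simp only [conjMulPow, map_zero, zero_mul, norm_zero]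
    positivity
  · have hz' : 0 < ‖z‖ := norm_pos_iff.2 hz
    rw [conjMulPow, norm_mul, RCLike.norm_conj, Complex.norm_real, Real.norm_eq_abs,
      abs_of_nonneg (by positivity)]
    nth_rewrite 1 [← Real.rpow_one ‖z‖]
    rw [← Real.rpow_add hz']
    apply le_of_eq
    congr 1
    ring

/-- The Plancherel–Pólya inequality on a compact set, under a growth bound with the exact exponents
`σ`. The function `h w = ∫ s in K, f (s + w y) g s`, with `g` dual to `s ↦ f (s + i y)`, has
exponential type `∑ σ j * |y j|`, is bounded on the real line by Hölder and the translation
invariance of Lebesgue measure, and its value at `i` is the integral to be estimated. -/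
theorem lintegral_enorm_rpow_add_mul_I_le_aux {d : ℕ} {r : ℝ} (hr : 1 ≤ r)
    {f : (Fin d → ℂ) → ℂ} (hf : Differentiable ℂ f) {σ : Fin d → ℝ} {A : ℝ}
    (hA : ∀ z : Fin d → ℂ, ‖f z‖ ≤ A * Real.exp (∑ j, σ j * ‖z j‖))
    (hσ : ∀ j, 0 ≤ σ j)
    (hN : ∫⁻ x, ‖restrictReal f x‖ₑ ^ r ≠ ∞) (y : Fin d → ℝ)
    {K : Set (Fin d → ℝ)} (hK : IsCompact K) :
    ∫⁻ x in K, ‖f (fun j => x j + y j * Complex.I)‖ₑ ^ r ≤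
      ENNReal.ofReal (Real.exp (r * ∑ j, σ j * |y j|)) * ∫⁻ x, ‖restrictReal f x‖ₑ ^ r := by
  have hr0 : 0 < r := by linarith
  have hKm := hK.measurableSet
  have hA0 : 0 ≤ A := by
    have := (norm_nonneg _).trans (hA 0)
    simpa using this
  set N := ∫⁻ x, ‖restrictReal f x‖ₑ ^ r with hNdef
  set τ := ∑ j, σ j * |y j| with hτ
  set Φ : (Fin d → ℝ) → ℂ → ℂ := fun s w => f (fun j => s j + w * y j) with hΦ
  have hΦc : Continuous Φ.uncurry := by
    refine hf.continuous.comp ?_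
    fun_prop
  have hΦd : ∀ s, Differentiable ℂ (Φ s) := by
    intro s
    refine hf.comp ?_
    fun_prop
  have hΦs : ∀ w, Continuous fun s => Φ s w := fun w => hΦc.comp (Continuous.prodMk_left w)
  set u : (Fin d → ℝ) → ℂ := fun s => Φ s Complex.I with hu
  have hint : ∀ x : Fin d → ℝ, f (fun j => x j + y j * Complex.I) = u x := by
    intro x; simp only [hu, hΦ, mul_comm]
  simp_rw [hint]
  set J := ∫⁻ x in K, ‖u x‖ₑ ^ r with hJ
  have huc : Continuous u := hΦs _
  set g : (Fin d → ℝ) → ℂ := fun s => conjMulPow r (u s) with hg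
  have hgm : Measurable g := (measurable_conjMulPow r).comp huc.measurable
  obtain ⟨B, hB⟩ := hK.exists_bound_of_continuousOn huc.continuousOn
  have hgB : ∀ s ∈ K, ‖g s‖ ≤ B ^ (r - 1) := fun s hs =>
    (norm_conjMulPow_le r _).trans
      (Real.rpow_le_rpow (norm_nonneg _) (hB s hs) (by linarith))
  have hJint : IntegrableOn (fun s => ‖u s‖ ^ r) K :=
    (huc.norm.rpow_const fun _ => Or.inr hr0.le).continuousOn.integrableOn_compact hK
  have henorm : ∀ z : ℂ, ‖z‖ₑ ^ r = ENNReal.ofReal (‖z‖ ^ r) := fun z => by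
    rw [← ofReal_norm, ENNReal.ofReal_rpow_of_nonneg (norm_nonneg _) hr0.le]
  have hJeq : J = ENNReal.ofReal (∫ s in K, ‖u s‖ ^ r) := by
    rw [ofReal_integral_eq_lintegral_ofReal hJint
      (Filter.Eventually.of_forall fun _ => by positivity)]
    exact lintegral_congr fun s => henorm _
  have hJtop : J ≠ ∞ := hJeq ▸ ENNReal.ofReal_ne_top
  set h : ℂ → ℂ := fun w => ∫ s in K, Φ s w * g s with hh
  have hhd : Differentiable ℂ h :=
    differentiable_integral_mul_of_isCompact hK hKm hΦc hΦd hgm hgB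
  have hhI : ‖h Complex.I‖ₑ = J := by
    have h1 : h Complex.I = ((∫ s in K, ‖u s‖ ^ r : ℝ) : ℂ) := by
      rw [← integral_complex_ofReal]
      exact integral_congr_ae (Filter.Eventually.of_forall fun s => mul_conjMulPow hr _)
    rw [h1, hJeq, ← ofReal_norm, Complex.norm_real, Real.norm_eq_abs,
      abs_of_nonneg (integral_nonneg fun _ => by positivity)]
  have hreal : ∀ x : ℝ, ‖h x‖ₑ ^ r ≤ N * J ^ (r - 1) := by
    intro x
    have h1 : ‖h x‖ₑ ≤ ∫⁻ s in K, ‖Φ s x‖ₑ * ‖u s‖ₑ ^ (r - 1) := by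
      refine (enorm_integral_le_lintegral_enorm _).trans (lintegral_mono fun s => ?_)
      rw [enorm_mul]
      gcongr
      rw [← ofReal_norm, ← ofReal_norm,
        ENNReal.ofReal_rpow_of_nonneg (norm_nonneg _) (by linarith)]
      exact ENNReal.ofReal_le_ofReal (norm_conjMulPow_le r _)
    refine (ENNReal.rpow_le_rpow h1 hr0.le).trans ((lintegral_mul_rpow_le
      (hΦs x).enorm.aemeasurable huc.enorm.aemeasurable hr).trans ?_)
    gcongr
    refine (setLIntegral_le_lintegral _ _).trans_eq ?_
    rw [hNdef, ← lintegral_add_right_eq_self (fun s => ‖restrictReal f s‖ₑ ^ r)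
      (fun j => x * y j)]
    simp [restrictReal, hΦ]
  have hPtop : N * J ^ (r - 1) ≠ ∞ :=
    ENNReal.mul_ne_top hN (ENNReal.rpow_ne_top_of_nonneg (by linarith) hJtop)
  obtain ⟨ρ, hρ⟩ := hK.isBounded.exists_norm_le
  have key : ‖h Complex.I‖ ≤ Real.exp τ * ((N * J ^ (r - 1)) ^ (1 / r)).toReal := by
    refine norm_apply_I_le_of_exp_type hhd
      (A := A * Real.exp (∑ j, σ j * ρ) * B ^ (r - 1) * (volume K).toReal) ?_ ?_
    · intro w
      have h1 : ∀ s ∈ K, ‖Φ s w * g s‖ ≤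
          A * Real.exp (∑ j, σ j * ρ + τ * ‖w‖) * B ^ (r - 1) := by
        intro s hs
        rw [norm_mul]
        refine mul_le_mul ((hA _).trans ?_) (hgB s hs) (norm_nonneg _) (by positivity)
        gcongr
        rw [hτ, Finset.sum_mul, ← Finset.sum_add_distrib]
        refine Finset.sum_le_sum fun j _ => ?_
        have h2 : ‖(s j : ℂ) + w * y j‖ ≤ ρ + |y j| * ‖w‖ := by
          refine (norm_add_le _ _).trans (add_le_add ?_ ?_)
          · rw [Complex.norm_real]
            exact (norm_le_pi_norm s j).trans (hρ s hs)
          · rw [norm_mul, Complex.norm_real, mul_comm, Real.norm_eq_abs]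
        calc σ j * ‖(s j : ℂ) + w * y j‖ ≤ σ j * (ρ + |y j| * ‖w‖) :=
              mul_le_mul_of_nonneg_left h2 (hσ j)
          _ = _ := by ring
      refine (norm_setIntegral_le_of_norm_le_const hK.measure_lt_top h1).trans_eq ?_
      rw [Real.exp_add, Measure.real]
      ring
    · intro x
      have h1 : ‖h x‖ₑ ≤ (N * J ^ (r - 1)) ^ (1 / r) := by
        rw [one_div, ENNReal.le_rpow_inv_iff hr0]
        exact hreal x
      rw [← toReal_enorm]
      exact ENNReal.toReal_mono (ENNReal.rpow_ne_top_of_nonneg (by positivity) hPtop) h1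
  have key2 : J ≤ ENNReal.ofReal (Real.exp τ) * (N * J ^ (r - 1)) ^ (1 / r) := by
    refine hhI.symm.trans_le ?_
    rw [← ofReal_norm]
    refine (ENNReal.ofReal_le_ofReal key).trans_eq ?_
    rw [ENNReal.ofReal_mul (Real.exp_pos _).le, ENNReal.ofReal_toReal]
    exact ENNReal.rpow_ne_top_of_nonneg (by positivity) hPtop
  -- A factor `J ^ (r - 1)` can be cancelled since `J` is finite and, from here on, nonzero.
  rcases eq_or_ne J 0 with h0 | h0
  · simp [h0]
  have key3 : J * J ^ (r - 1) ≤ ENNReal.ofReal (Real.exp (r * τ)) * N * J ^ (r - 1) := by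
    have h1 := ENNReal.rpow_le_rpow key2 hr0.le
    rw [ENNReal.mul_rpow_of_nonneg _ _ hr0.le, ← ENNReal.rpow_mul, one_div_mul_cancel hr0.ne',
      ENNReal.rpow_one, ENNReal.ofReal_rpow_of_nonneg (Real.exp_pos _).le hr0.le, ← Real.exp_mul,
      mul_comm τ r, ← mul_assoc] at h1
    refine le_trans (le_of_eq ?_) h1
    nth_rewrite 1 [← ENNReal.rpow_one J]
    rw [← ENNReal.rpow_add _ _ h0 hJtop]
    congr 1; ring
  exact (ENNReal.mul_le_mul_iff_left
    (by simp [h0, hJtop]) (ENNReal.rpow_ne_top_of_nonneg (by linarith) hJtop)).1 key3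

/-- The **Plancherel–Pólya inequality**: passing from `ℝ^d` to its translate `ℝ^d + i y` increases
the `L^r` norm of a function of exponential type `σ` by at most the factor
`exp (∑ σ j * |y j|)`. -/
theorem lintegral_enorm_rpow_add_mul_I_le {d : ℕ} {r : ℝ} (hr : 1 ≤ r)
    {f : (Fin d → ℂ) → ℂ} {σ : Fin d → ℝ} (hf : IsEntireOfExpType σ f) (hσ : ∀ j, 0 ≤ σ j)
    (hN : ∫⁻ x, ‖restrictReal f x‖ₑ ^ r ≠ ∞) (y : Fin d → ℝ) :
    ∫⁻ x : Fin d → ℝ, ‖f (fun j => x j + y j * Complex.I)‖ₑ ^ r ≤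
      ENNReal.ofReal (Real.exp (r * ∑ j, σ j * |y j|)) * ∫⁻ x, ‖restrictReal f x‖ₑ ^ r := by
  have hcomp : ∀ K : Set (Fin d → ℝ), IsCompact K →
      ∫⁻ x in K, ‖f (fun j => x j + y j * Complex.I)‖ₑ ^ r ≤
      ENNReal.ofReal (Real.exp (r * ∑ j, σ j * |y j|)) * ∫⁻ x, ‖restrictReal f x‖ₑ ^ r := by
    intro K hK
    have hlim : Filter.Tendsto (fun ε : ℝ =>
        ENNReal.ofReal (Real.exp (r * ∑ j, (σ j + ε) * |y j|)) *
          ∫⁻ x, ‖restrictReal f x‖ₑ ^ r) (nhdsWithin 0 (Set.Ioi 0))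
        (nhds (ENNReal.ofReal (Real.exp (r * ∑ j, σ j * |y j|)) *
          ∫⁻ x, ‖restrictReal f x‖ₑ ^ r)) := by
      refine ENNReal.Tendsto.mul_const (ENNReal.tendsto_ofReal ?_) (Or.inr hN)
      refine Filter.Tendsto.mono_left ?_ nhdsWithin_le_nhds
      exact Continuous.tendsto' (by fun_prop) _ _ (by simp)
    refine ge_of_tendsto hlim ?_
    filter_upwards [self_mem_nhdsWithin] with ε hε
    obtain ⟨A, hA⟩ := hf.2 ε hε
    exact lintegral_enorm_rpow_add_mul_I_le_aux hr hf.1 hA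
      (fun j => add_nonneg (hσ j) (le_of_lt hε)) hN y hK
  rw [← setLIntegral_univ, ← Metric.iUnion_closedBall_nat (0 : Fin d → ℝ),
    setLIntegral_iUnion_of_directed _ (Monotone.directed_le fun m n hmn =>
      Metric.closedBall_subset_closedBall (by exact_mod_cast hmn))]
  exact iSup_le fun n => hcomp _ (isCompact_closedBall _ _)

/-! ### The sub-mean-value property on polydiscs -/

theorem enorm_le_lintegral_circleMap {φ : ℂ → ℂ} (hφ : Differentiable ℂ φ) :
    ‖φ 0‖ₑ ≤ ENNReal.ofReal (2 * Real.pi)⁻¹ *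
      ∫⁻ θ in Set.Ioc 0 (2 * Real.pi), ‖φ (circleMap 0 1 θ)‖ₑ := by
  have h1 : Real.circleAverage φ 0 1 = φ 0 := DiffContOnCl.circleAverage hφ.diffContOnCl
  rw [← h1, Real.circleAverage_def, intervalIntegral.integral_of_le Real.two_pi_pos.le, enorm_smul,
    Real.enorm_of_nonneg (by positivity)]
  gcongr
  exact enorm_integral_le_lintegral_enorm _

theorem measurePreserving_rotation_pi {d : ℕ} (c : Fin d → ℂ) (a : Circle) :
    MeasurePreserving (fun (z : Fin d → ℂ) l => c l + a * (z l - c l)) := by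
  refine volume_preserving_pi (f := fun l w => c l + a * (w - c l)) fun l => ?_
  exact (measurePreserving_add_left volume (c l)).comp
    ((rotation a).measurePreserving.comp (measurePreserving_sub_right volume (c l)))

/-- The sub-mean-value inequality for `|f|` on a polydisc. No induction on the dimension is needed:
the diagonal rotations `z ↦ c + e^{iθ} (z - c)` preserve both the polydisc and the volume, so
integrating over the polydisc the one-variable mean value property on each circle
`θ ↦ c + e^{iθ} (z - c)` gives the claim. -/
theorem enorm_mul_volume_polydisc_le {d : ℕ} {f : (Fin d → ℂ) → ℂ} (hf : Differentiable ℂ f)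
    (c : Fin d → ℂ) (ρ : Fin d → ℝ) :
    ‖f c‖ₑ * volume (Set.univ.pi fun l => Metric.ball (c l) (ρ l)) ≤
      ∫⁻ z in Set.univ.pi fun l => Metric.ball (c l) (ρ l), ‖f z‖ₑ := by
  set D := Set.univ.pi fun l => Metric.ball (c l) (ρ l) with hD
  have hDm : MeasurableSet D := MeasurableSet.univ_pi fun l => measurableSet_ball
  set R : ℝ → (Fin d → ℂ) → (Fin d → ℂ) := fun θ z l => c l + circleMap 0 1 θ * (z l - c l)
    with hR
  have hRc : Continuous R.uncurry := by
    refine continuous_pi fun l => ?_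
    simp only [hR, Function.uncurry]
    fun_prop
  have hRD : ∀ θ, R θ ⁻¹' D = D := by
    intro θ
    ext z
    simp [hR, hD, Set.mem_pi, dist_eq_norm]
  have hRm : ∀ θ, MeasurePreserving (R θ) := by
    intro θ
    have := measurePreserving_rotation_pi c (Circle.exp θ)
    simpa [hR, circleMap] using this
  have hmean : ∀ z, ‖f c‖ₑ ≤ ENNReal.ofReal (2 * Real.pi)⁻¹ *
      ∫⁻ θ in Set.Ioc 0 (2 * Real.pi), ‖f (R θ z)‖ₑ := by
    intro z
    have hφ : Differentiable ℂ (fun u : ℂ => f (fun l => c l + u * (z l - c l))) := by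
      refine hf.comp ?_
      fun_prop
    simpa using enorm_le_lintegral_circleMap hφ
  calc ‖f c‖ₑ * volume D = ∫⁻ _ in D, ‖f c‖ₑ := by rw [setLIntegral_const]
    _ ≤ ∫⁻ z in D, ENNReal.ofReal (2 * Real.pi)⁻¹ *
        ∫⁻ θ in Set.Ioc 0 (2 * Real.pi), ‖f (R θ z)‖ₑ := lintegral_mono hmean
    _ = ENNReal.ofReal (2 * Real.pi)⁻¹ *
        ∫⁻ z in D, ∫⁻ θ in Set.Ioc 0 (2 * Real.pi), ‖f (R θ z)‖ₑ :=
      lintegral_const_mul' _ _ ENNReal.ofReal_ne_top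
    _ = ENNReal.ofReal (2 * Real.pi)⁻¹ *
        ∫⁻ θ in Set.Ioc 0 (2 * Real.pi), ∫⁻ z in D, ‖f (R θ z)‖ₑ := by
      rw [lintegral_lintegral_swap]
      exact ((hf.continuous.comp (hRc.comp continuous_swap)).enorm).aemeasurable
    _ = ENNReal.ofReal (2 * Real.pi)⁻¹ *
        ∫⁻ _ in Set.Ioc 0 (2 * Real.pi), ∫⁻ z in D, ‖f z‖ₑ := by
      congr 1
      refine lintegral_congr fun θ => ?_
      rw [← (hRm θ).setLIntegral_comp_preimage hDm hf.continuous.enorm.measurable, hRD]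
    _ = ∫⁻ z in D, ‖f z‖ₑ := by
      rw [setLIntegral_const, Real.volume_Ioc, sub_zero, mul_comm (lintegral _ _), ← mul_assoc,
        ← ENNReal.ofReal_mul (by positivity), inv_mul_cancel₀ (by positivity), ENNReal.ofReal_one,
        one_mul]

theorem volume_polydisc {d : ℕ} (c : Fin d → ℂ) {ρ : Fin d → ℝ} (hρ : ∀ l, 0 ≤ ρ l) :
    volume (Set.univ.pi fun l => Metric.ball (c l) (ρ l)) =
      ENNReal.ofReal (∏ l, ρ l ^ 2 * Real.pi) := by
  rw [volume_pi_pi, ENNReal.ofReal_prod_of_nonneg fun l _ => by positivity]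
  refine Finset.prod_congr rfl fun l _ => ?_
  rw [Complex.volume_ball, ENNReal.ofReal_mul (by positivity), ENNReal.ofReal_pow (hρ l)]
  congr 1
  rw [← NNReal.coe_real_pi, ENNReal.ofReal_coe_nnreal]

/-- The sub-mean-value inequality for `|f| ^ r` on a polydisc, from that for `|f|` by Hölder. -/
theorem enorm_rpow_mul_volume_polydisc_le {d : ℕ} {r : ℝ} (hr : 1 ≤ r) {f : (Fin d → ℂ) → ℂ}
    (hf : Differentiable ℂ f) (c : Fin d → ℂ) {ρ : Fin d → ℝ} (hρ : ∀ l, 0 < ρ l) :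
    ‖f c‖ₑ ^ r * volume (Set.univ.pi fun l => Metric.ball (c l) (ρ l)) ≤
      ∫⁻ z in Set.univ.pi fun l => Metric.ball (c l) (ρ l), ‖f z‖ₑ ^ r := by
  have hr0 : 0 < r := by linarith
  set D := Set.univ.pi fun l => Metric.ball (c l) (ρ l) with hD
  have hvol : volume D = ENNReal.ofReal (∏ l, ρ l ^ 2 * Real.pi) :=
    volume_polydisc c fun l => (hρ l).le
  have hV0 : volume D ≠ 0 := by
    rw [hvol, Ne, ENNReal.ofReal_eq_zero, not_le]
    exact Finset.prod_pos fun l _ => mul_pos (pow_pos (hρ l) 2) Real.pi_pos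
  have hVtop : volume D ≠ ∞ := hvol ▸ ENNReal.ofReal_ne_top
  have h1 := ENNReal.rpow_le_rpow (enorm_mul_volume_polydisc_le hf c ρ) hr0.le
  have h2 := lintegral_mul_rpow_le (μ := volume.restrict D) (u := fun z => ‖f z‖ₑ)
    (v := fun _ => 1) hf.continuous.enorm.aemeasurable aemeasurable_const hr
  simp only [ENNReal.one_rpow, mul_one, lintegral_const, one_mul, Measure.restrict_apply,
    MeasurableSet.univ, Set.univ_inter] at h2
  have h3 := h1.trans h2
  rw [ENNReal.mul_rpow_of_nonneg _ _ hr0.le] at h3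
  refine (ENNReal.mul_le_mul_iff_left (c := volume D ^ (r - 1))
    (by simp [hV0, hVtop]) (ENNReal.rpow_ne_top_of_nonneg (by linarith) hVtop)).1
    (le_trans (le_of_eq ?_) h3)
  rw [mul_assoc]
  congr 1
  nth_rewrite 1 [← ENNReal.rpow_one (volume D)]
  rw [← ENNReal.rpow_add _ _ hV0 hVtop]
  congr 1
  ring

/-! ### Integration over a strip around the real subspace -/

theorem setIntegral_exp_mul_abs {k a : ℝ} (hk : k ≠ 0) (ha : 0 ≤ a) :
    ∫ y in Set.Icc (-a) a, Real.exp (k * |y|) = 2 * (Real.exp (k * a) - 1) / k := by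
  have hc : Continuous fun y : ℝ => Real.exp (k * |y|) := by fun_prop
  rw [integral_Icc_eq_integral_Ioc, ← intervalIntegral.integral_of_le (by linarith),
    ← intervalIntegral.integral_add_adjacent_intervals (b := 0)
      (hc.intervalIntegrable _ _) (hc.intervalIntegrable _ _)]
  have h1 : ∫ y in (0 : ℝ)..a, Real.exp (k * |y|) = (Real.exp (k * a) - 1) / k := by
    rw [intervalIntegral.integral_congr (g := fun y => Real.exp (k * y)) fun y hy => by
      rw [Set.uIcc_of_le ha] at hy
      simp only [abs_of_nonneg hy.1], intervalIntegral.integral_comp_mul_left _ hk, integral_exp]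
    simp [div_eq_inv_mul]
  have h2 : ∫ y in (-a)..0, Real.exp (k * |y|) = ∫ y in (0 : ℝ)..a, Real.exp (k * |y|) := by
    have := intervalIntegral.integral_comp_neg (a := 0) (b := a)
      (fun y : ℝ => Real.exp (k * |y|))
    simpa using this.symm
  rw [h2, h1]
  ring

theorem lintegral_exp_sum_mul_abs {d : ℕ} {k a : Fin d → ℝ} (hk : ∀ l, k l ≠ 0)
    (ha : ∀ l, 0 ≤ a l) :
    ∫⁻ y in Set.univ.pi fun l => Set.Icc (-a l) (a l),
        ENNReal.ofReal (Real.exp (∑ l, k l * |y l|)) =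
      ENNReal.ofReal (∏ l, 2 * (Real.exp (k l * a l) - 1) / k l) := by
  have hc : Continuous fun y : Fin d → ℝ => Real.exp (∑ l, k l * |y l|) := by fun_prop
  have hK : IsCompact (Set.univ.pi fun l => Set.Icc (-a l) (a l)) :=
    isCompact_univ_pi fun l => isCompact_Icc
  rw [← ofReal_integral_eq_lintegral_ofReal (hc.continuousOn.integrableOn_compact hK)
    (Filter.Eventually.of_forall fun _ => (Real.exp_pos _).le)]
  congr 1
  simp_rw [Real.exp_sum]
  rw [volume_pi, Measure.restrict_pi_pi]
  rw [integral_fintype_prod_eq_prod (f := fun l (y : ℝ) => Real.exp (k l * |y|))]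
  exact Finset.prod_congr rfl fun l _ => setIntegral_exp_mul_abs (hk l) (ha l)

theorem measurePreserving_add_mul_I (d : ℕ) :
    MeasurePreserving (fun (p : (Fin d → ℝ) × (Fin d → ℝ)) (l : Fin d) =>
      (p.1 l : ℂ) + p.2 l * Complex.I) := by
  have h := (volume_preserving_pi fun _ : Fin d =>
    Complex.volume_preserving_equiv_real_prod.symm).comp
      (volume_measurePreserving_arrowProdEquivProdArrow ℝ ℝ (Fin d)).symm
  convert h using 1
  funext p l
  exact (Complex.mk_eq_add_mul_I _ _).symm

theorem lintegral_strip_le {d : ℕ} {r : ℝ} (hr : 1 ≤ r)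
    {f : (Fin d → ℂ) → ℂ} {σ : Fin d → ℝ} (hf : IsEntireOfExpType σ f) (hσ : ∀ j, 0 < σ j)
    (hN : ∫⁻ x, ‖restrictReal f x‖ₑ ^ r ≠ ∞) {a : Fin d → ℝ} (ha : ∀ l, 0 ≤ a l) :
    ∫⁻ z in {z : Fin d → ℂ | ∀ l, |(z l).im| ≤ a l}, ‖f z‖ₑ ^ r ≤
      ENNReal.ofReal (∏ l, 2 * (Real.exp (r * σ l * a l) - 1) / (r * σ l)) *
        ∫⁻ x, ‖restrictReal f x‖ₑ ^ r := by
  have hr0 : 0 < r := by linarith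
  have hS : MeasurableSet {z : Fin d → ℂ | ∀ l, |(z l).im| ≤ a l} := by
    refine IsClosed.measurableSet ?_
    simp only [Set.ofPred_forall]
    exact isClosed_iInter fun l => isClosed_le (by fun_prop) continuous_const
  have hfm : Measurable fun z => ‖f z‖ₑ ^ r := hf.1.continuous.enorm.measurable.pow_const r
  have hpre : (fun (p : (Fin d → ℝ) × (Fin d → ℝ)) (l : Fin d) =>
      (p.1 l : ℂ) + p.2 l * Complex.I) ⁻¹' {z : Fin d → ℂ | ∀ l, |(z l).im| ≤ a l} =
      Set.univ ×ˢ (Set.univ.pi fun l => Set.Icc (-a l) (a l)) := by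
    ext p
    simp only [Set.mem_preimage, Set.mem_ofPred_eq, Set.mem_prod, Set.mem_univ, true_and,
      Set.mem_univ_pi, Set.mem_Icc, ← abs_le]
    simp
  rw [← (measurePreserving_add_mul_I d).setLIntegral_comp_preimage hS hfm, hpre,
    Measure.volume_eq_prod, ← Measure.prod_restrict, Measure.restrict_univ,
    lintegral_prod_symm (f := fun p : (Fin d → ℝ) × (Fin d → ℝ) =>
      ‖f fun l => (p.1 l : ℂ) + p.2 l * Complex.I‖ₑ ^ r)
      (hfm.comp (measurePreserving_add_mul_I d).measurable).aemeasurable]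
  refine (lintegral_mono fun y =>
    lintegral_enorm_rpow_add_mul_I_le hr hf (fun j => (hσ j).le) hN y).trans_eq ?_
  rw [lintegral_mul_const' _ _ hN, ← lintegral_exp_sum_mul_abs
    (fun l => (mul_pos hr0 (hσ l)).ne') ha]
  simp_rw [Finset.mul_sum, mul_assoc]

/-! ### Sampling along separated product sequences -/

/-- The sampling inequality in `ℝ≥0∞`, where no summability has to be tracked: the polydiscs of
radii `δ l / 2` around the sampling points are disjoint and lie in the strip `|Im z l| ≤ δ l / 2`. -/
theorem tsum_enorm_rpow_le {d : ℕ} {r : ℝ} (hr : 1 ≤ r)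
    {σ : Fin d → ℝ} (hσ : ∀ l, 0 < σ l) {δ : Fin d → ℝ} (hδ : ∀ l, 0 < δ l)
    {t : Fin d → ℤ → ℝ} (ht : ∀ l, ∀ n m : ℤ, n ≠ m → δ l ≤ |t l n - t l m|)
    {f : (Fin d → ℂ) → ℂ} (hf : IsEntireOfExpType σ f)
    (hN : ∫⁻ x, ‖restrictReal f x‖ₑ ^ r ≠ ∞) :
    ∑' n : Fin d → ℤ, ‖restrictReal f (fun l => t l (n l))‖ₑ ^ r ≤
      ENNReal.ofReal (plancherelPolyaConst r σ δ) * ∫⁻ x, ‖restrictReal f x‖ₑ ^ r := by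
  have hr0 : 0 < r := by linarith
  set N := ∫⁻ x, ‖restrictReal f x‖ₑ ^ r with hNdef
  set D : (Fin d → ℤ) → Set (Fin d → ℂ) := fun n =>
    Set.univ.pi fun l => Metric.ball ((t l (n l) : ℝ) : ℂ) (δ l / 2) with hD
  have hDm : ∀ n, MeasurableSet (D n) := fun n =>
    MeasurableSet.univ_pi fun l => measurableSet_ball
  have hdisj : Pairwise (Function.onFun Disjoint D) := by
    intro n m hnm
    obtain ⟨l, hl⟩ := Function.ne_iff.1 hnm
    refine Set.disjoint_univ_pi.2 ⟨l, Metric.ball_disjoint_ball ?_⟩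
    rw [add_halves, Complex.dist_eq, ← Complex.ofReal_sub, Complex.norm_real, Real.norm_eq_abs]
    exact ht l _ _ hl
  have hsub : ⋃ n, D n ⊆ {z : Fin d → ℂ | ∀ l, |(z l).im| ≤ δ l / 2} := by
    refine Set.iUnion_subset fun n z hz l => ?_
    have h1 : ‖z l - (t l (n l) : ℝ)‖ < δ l / 2 := by
      simpa [dist_eq_norm] using hz l (Set.mem_univ l)
    have h2 := Complex.abs_im_le_norm (z l - (t l (n l) : ℝ))
    simp only [Complex.sub_im, Complex.ofReal_im, sub_zero] at h2
    linarith
  set v : ℝ := ∏ l, (δ l / 2) ^ 2 * Real.pi with hv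
  have hv0 : 0 < v := Finset.prod_pos fun l _ =>
    mul_pos (pow_pos (half_pos (hδ l)) 2) Real.pi_pos
  have hsum : (∑' n : Fin d → ℤ, ‖restrictReal f (fun l => t l (n l))‖ₑ ^ r) * ENNReal.ofReal v ≤
      ENNReal.ofReal (∏ l, 2 * (Real.exp (r * σ l * (δ l / 2)) - 1) / (r * σ l)) * N := by
    rw [← ENNReal.tsum_mul_right]
    calc ∑' n : Fin d → ℤ, ‖restrictReal f (fun l => t l (n l))‖ₑ ^ r * ENNReal.ofReal v
        ≤ ∑' n, ∫⁻ z in D n, ‖f z‖ₑ ^ r := by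
          refine ENNReal.tsum_le_tsum fun n => ?_
          rw [hv, ← volume_polydisc (fun l => ((t l (n l) : ℝ) : ℂ))
            fun l => (half_pos (hδ l)).le]
          exact enorm_rpow_mul_volume_polydisc_le hr hf.1 _ fun l => half_pos (hδ l)
      _ = ∫⁻ z in ⋃ n, D n, ‖f z‖ₑ ^ r := (lintegral_iUnion hDm hdisj _).symm
      _ ≤ ∫⁻ z in {z : Fin d → ℂ | ∀ l, |(z l).im| ≤ δ l / 2}, ‖f z‖ₑ ^ r :=
          lintegral_mono_set hsub
      _ ≤ _ := lintegral_strip_le hr hf hσ hN fun l => (half_pos (hδ l)).le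
  have hconst : ∏ l, 2 * (Real.exp (r * σ l * (δ l / 2)) - 1) / (r * σ l) =
      plancherelPolyaConst r σ δ * v := by
    rw [plancherelPolyaConst, hv, ← Fin.prod_const, ← Finset.prod_mul_distrib,
      ← Finset.prod_mul_distrib]
    refine Finset.prod_congr rfl fun l _ => ?_
    have := hσ l
    have := hδ l
    rw [show r * σ l * (δ l / 2) = r * δ l * σ l / 2 by ring]
    field_simp
    ring
  rw [hconst, ENNReal.ofReal_mul' hv0.le, mul_right_comm] at hsum
  exact (ENNReal.mul_le_mul_iff_left (by simpa using hv0) ENNReal.ofReal_ne_top).1 hsum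

theorem plancherelPolyaConst_nonneg {d : ℕ} {r : ℝ} (hr : 0 ≤ r) {σ δ : Fin d → ℝ}
    (hσ : ∀ l, 0 ≤ σ l) (hδ : ∀ l, 0 ≤ δ l) : 0 ≤ plancherelPolyaConst r σ δ := by
  refine mul_nonneg (by positivity) (Finset.prod_nonneg fun l _ => ?_)
  refine div_nonneg (sub_nonneg.2 (Real.one_le_exp ?_)) (mul_nonneg (hσ l) (sq_nonneg _))
  have := mul_nonneg (mul_nonneg hr (hδ l)) (hσ l)
  linarith

theorem theorem1 (d : ℕ) (r : ℝ) (hr : 1 ≤ r)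
    (σ : Fin d → ℝ) (hσ : ∀ l, 0 < σ l)
    (δ : Fin d → ℝ) (hδ : ∀ l, 0 < δ l)
    (t : Fin d → ℤ → ℝ) (ht : ∀ l, ∀ n m : ℤ, n ≠ m → δ l ≤ |t l n - t l m|)
    (f : (Fin d → ℂ) → ℂ) (hf : f ∈ bernsteinClass σ (ENNReal.ofReal r)) :
    Summable (fun n : Fin d → ℤ => ‖restrictReal f (fun l => t l (n l))‖ ^ r) ∧
      ∑' n : Fin d → ℤ, ‖restrictReal f (fun l => t l (n l))‖ ^ r ≤
        plancherelPolyaConst r σ δ *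
          (eLpNorm (restrictReal f) (ENNReal.ofReal r) volume).toReal ^ r := by
  have hr0 : 0 < r := by linarith
  obtain ⟨hfe, hfL⟩ := hf
  have hNeq : ∫⁻ x, ‖restrictReal f x‖ₑ ^ r =
      eLpNorm (restrictReal f) (ENNReal.ofReal r) volume ^ r := by
    rw [eLpNorm_eq_lintegral_rpow_enorm_toReal (by simpa using hr0) ENNReal.ofReal_ne_top,
      ENNReal.toReal_ofReal hr0.le, ← ENNReal.rpow_mul, one_div_mul_cancel hr0.ne',
      ENNReal.rpow_one]
  have hN : ∫⁻ x, ‖restrictReal f x‖ₑ ^ r ≠ ∞ := by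
    rw [hNeq]
    exact ENNReal.rpow_ne_top_of_nonneg hr0.le hfL.eLpNorm_ne_top
  have hmain := tsum_enorm_rpow_le hr hσ hδ ht hfe hN
  have htop := ENNReal.mul_ne_top (ENNReal.ofReal_ne_top (r := plancherelPolyaConst r σ δ)) hN
  have hterm : ∀ n : Fin d → ℤ, ‖restrictReal f (fun l => t l (n l))‖ ^ r =
      (‖restrictReal f (fun l => t l (n l))‖ₑ ^ r).toReal := fun n => by
    rw [← ENNReal.toReal_rpow, toReal_enorm]
  simp_rw [hterm]
  refine ⟨ENNReal.summable_toReal (ne_top_of_le_ne_top htop hmain), ?_⟩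
  rw [← ENNReal.tsum_toReal_eq fun n => ENNReal.rpow_ne_top_of_nonneg hr0.le enorm_ne_top]
  refine (ENNReal.toReal_mono htop hmain).trans_eq ?_
  rw [ENNReal.toReal_mul, ENNReal.toReal_ofReal
    (plancherelPolyaConst_nonneg hr0.le (fun l => (hσ l).le) fun l => (hδ l).le), hNeq,
    ENNReal.toReal_rpow]
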